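/- Let $G$ be a group acting on a non-empty set $S$. Suppose that the action is oligomorphic, i.e. for every $n \in \mathbb{N}$ the group $G$ has only finitely many orbits on the set of $n$-element subsets of $S$. Suppose further that for every non-empty finite subset $A \subseteq S$ the (setwise) stabiliser $\{g \in G : gA = A\}$ is of type $\mathrm{FP}_\infty$. Then $G$ is of type $\mathrm{FP}_\infty$. Here a group $H$ is of type $\mathrm{FP}_n$ if the trivial $\mathbb{Z}H$-module $\mathbb{Z}$ has a projective resolution $\cdots \to P_1 \to P_0 \to \mathbb{Z} \to 0$ by $\mathbb{Z}H$-modules with $P_i$ finitely generated for all $i \le n$, and $H$ is of type $\mathrm{FP}_\infty$ if it is of type $\mathrm{FP}_n$ for every $n \in \mathbb{N}$. -/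

import Mathlib

universe u v

open CategoryTheory
open scoped Pointwise

/-- The trivial `ℤG`-module `ℤ`, lifted to the universe of `G`. -/
noncomputable abbrev trivialIntModule (G : Type u) [Group G] :
    ModuleCat.{u} (MonoidAlgebra ℤ G) :=
  ModuleCat.of (MonoidAlgebra ℤ G) (Representation.trivial ℤ G (ULift.{u} ℤ)).asModule

/-- `G` is of type `FP_n`: the trivial `ℤG`-module `ℤ` has a projective resolution by
`ℤG`-modules that is finitely generated in dimensions up to `n`. -/
def IsTypeFP (G : Type u) [Group G] (n : ℕ) : Prop :=
  ∃ P : ProjectiveResolution (trivialIntModule G),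
    ∀ i ≤ n, Module.Finite (MonoidAlgebra ℤ G) (P.complex.X i)

/-- `G` is of type `FP_∞`: it is of type `FP_n` for all `n`. -/
def IsTypeFPInfty (G : Type u) [Group G] : Prop :=
  ∀ n : ℕ, IsTypeFP G n

open scoped Classical in
/-- The action of `G` on `S` is oligomorphic: for every `n`, there are finitely many orbits of
`n`-element subsets of `S`. -/
def IsOligomorphic (G : Type u) (S : Type v) [Group G] [MulAction G S] : Prop :=
  ∀ n : ℕ, Finite (MulAction.orbitRel.Quotient G (Set.powersetCard S n))

/-! The augmented complex of tuples … → ℤ[S²] → ℤ[S] → ℤ is exact because S is non-empty: prepending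
a fixed point is a contracting homotopy. Tuples may repeat entries and come with an order, so each
term is a permutation module without orientation signs. Oligomorphy leaves only finitely many orbits
on each power of S (`IsOligomorphic.finite_orbits_tuples`), so each term is a finite sum of modules
induced from trivial modules of tuple stabilisers. Such a stabiliser has finite index in the setwise
stabiliser of the entries, hence is of type FP_∞ (`isTypeFPInfty_stabilizer_tuple`). Induction is
exact and preserves finitely generated projectives (`OrbitSection.isFP_ind`), so the terms inherit
every FP_n (`PermModule.isFP`), and dimension shifting (`IsFP.of_resolution`) carries this to ℤ.

Finiteness is tracked by the recursive condition `IsFP` on modules, matched with resolutions in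
`isTypeFP_iff_isFP`. It asks only for some cover at each stage, and each closure property used below
can build its own cover, so Schanuel's lemma is not needed. -/

/-- An `R`-module is of type `FP_n` if it is finitely generated and, for `n > 0`, it is a quotient
of a finitely generated projective module by a submodule of type `FP_{n-1}`. -/
def IsFP (R : Type u) [Ring R] : ℕ → ∀ (M : Type u) [AddCommGroup M] [Module R M], Prop
  | 0, M, _, _ => Module.Finite R M
  | n + 1, M, _, _ => ∃ (P : Type u) (_ : AddCommGroup P) (_ : Module R P) (g : P →ₗ[R] M),
      Module.Finite R P ∧ Module.Projective R P ∧ Function.Surjective g ∧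
        IsFP R n (LinearMap.ker g)

/-! ### Closure properties of modules of type FP_n -/

namespace IsFP

section

variable {R : Type u} [Ring R] {A B C M N : Type u} [AddCommGroup A] [Module R A]
  [AddCommGroup B] [Module R B] [AddCommGroup C] [Module R C]
  [AddCommGroup M] [Module R M] [AddCommGroup N] [Module R N]

theorem of_equiv {n : ℕ} (e : M ≃ₗ[R] N) (h : IsFP R n M) : IsFP R n N := by
  cases n with
  | zero =>
    have : Module.Finite R M := h
    exact Module.Finite.equiv e
  | succ n =>
    obtain ⟨P, _, _, g, hf, hp, hs, hk⟩ := h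
    refine ⟨P, _, _, e.toLinearMap ∘ₗ g, hf, hp, e.surjective.comp hs, ?_⟩
    rwa [LinearEquiv.ker_comp]

theorem finite {n : ℕ} (h : IsFP R n M) : Module.Finite R M := by
  cases n with
  | zero => exact h
  | succ n =>
    obtain ⟨P, _, _, g, hf, hp, hs, hk⟩ := h
    exact Module.Finite.of_surjective g hs

theorem ker_of_exact {n : ℕ} {f : A →ₗ[R] B} {g : B →ₗ[R] C} (hf : Function.Injective f)
    (hfg : Function.Exact f g) (h : IsFP R n A) : IsFP R n (LinearMap.ker g) :=
  h.of_equiv ((LinearEquiv.ofInjective f hf).trans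
    (LinearEquiv.ofEq _ _ (LinearMap.exact_iff.1 hfg).symm))

theorem succ_of_exact {n : ℕ} [Module.Finite R B] [Module.Projective R B] {f : A →ₗ[R] B}
    {g : B →ₗ[R] C} (hf : Function.Injective f) (hfg : Function.Exact f g)
    (hg : Function.Surjective g) (h : IsFP R n A) : IsFP R (n + 1) C :=
  ⟨B, _, _, g, inferInstance, inferInstance, hg, h.ker_of_exact hf hfg⟩

theorem of_subsingleton [Subsingleton M] (n : ℕ) : IsFP R n M := by
  induction n generalizing M with
  | zero => exact (inferInstance : Module.Finite R M)
  | succ n ih =>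
    exact ⟨M, _, _, LinearMap.id, inferInstance, inferInstance, Function.surjective_id, ih⟩

theorem of_projective [Module.Finite R M] [Module.Projective R M] (n : ℕ) : IsFP R n M := by
  cases n with
  | zero => exact (inferInstance : Module.Finite R M)
  | succ n =>
    have : Subsingleton (LinearMap.ker (LinearMap.id : M →ₗ[R] M)) := by
      rw [LinearMap.ker_id]; infer_instance
    exact ⟨M, _, _, LinearMap.id, inferInstance, inferInstance, Function.surjective_id,
      of_subsingleton n⟩

/-- Horseshoe argument: covers P of the kernel and Q of C give a cover P × Q of B, once Q → C is
lifted to B. The kernels of the three covers again form a short exact sequence, to which induction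
applies. -/
theorem extension {n : ℕ} (p : B →ₗ[R] C) (hp : Function.Surjective p)
    (hA : IsFP R n (LinearMap.ker p)) (hC : IsFP R n C) : IsFP R n B := by
  induction n generalizing B C with
  | zero =>
    have : Module.Finite R (LinearMap.ker p) := hA
    have : Module.Finite R C := hC
    have : Module.Finite R (B ⧸ LinearMap.ker p) :=
      Module.Finite.equiv (p.quotKerEquivOfSurjective hp).symm
    exact Module.Finite.of_submodule_quotient (LinearMap.ker p)
  | succ n ih =>
    obtain ⟨P, _, _, f, hPf, hPp, hf, hfk⟩ := hA
    obtain ⟨Q, _, _, g, hQf, hQp, hg, hgk⟩ := hC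
    obtain ⟨h, hh⟩ := Module.projective_lifting_property p g hp
    have hh' (x : Q) : p (h x) = g x := LinearMap.congr_fun hh x
    obtain ⟨k, hk⟩ : ∃ k : P × Q →ₗ[R] B, ∀ x, k x = f x.1 + h x.2 :=
      ⟨((LinearMap.ker p).subtype ∘ₗ f).coprod h, fun x => rfl⟩
    have hpk (x : P × Q) : p (k x) = g x.2 := by
      rw [hk, map_add, (f x.1).2, zero_add, hh']
    refine ⟨P × Q, inferInstance, inferInstance, k, inferInstance, inferInstance, ?_, ?_⟩
    · intro b
      obtain ⟨q, hq⟩ := hg (p b)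
      obtain ⟨a, ha⟩ := hf ⟨b - h q, by simp [hh', hq]⟩
      exact ⟨(a, q), by simp [hk, ha]⟩
    · let r : LinearMap.ker k →ₗ[R] LinearMap.ker g :=
        (LinearMap.snd R P Q).restrict fun x hx => by
          rw [LinearMap.mem_ker, LinearMap.snd_apply, ← hpk x, LinearMap.mem_ker.1 hx, map_zero]
      refine ih r ?_ ?_ hgk
      · rintro ⟨q, hq⟩
        obtain ⟨a, ha⟩ := hf ⟨- h q, by
          rw [LinearMap.mem_ker, map_neg, hh', LinearMap.mem_ker.1 hq, neg_zero]⟩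
        refine ⟨⟨(a, q), ?_⟩, rfl⟩
        rw [LinearMap.mem_ker, hk]
        dsimp only
        rw [ha]
        exact neg_add_cancel _
      · let i : LinearMap.ker f →ₗ[R] LinearMap.ker k :=
          (LinearMap.inl R P Q).restrict fun x hx => by
            rw [LinearMap.mem_ker, hk]
            simp [LinearMap.mem_ker.1 hx]
        refine hfk.ker_of_exact (f := i) ?_ ?_
        · intro x y hxy
          exact Subtype.ext (congrArg (fun z : LinearMap.ker k => z.1.1) hxy)
        · rintro ⟨⟨a, q⟩, hx⟩
          constructor
          · intro h0
            obtain rfl : q = 0 := congrArg Subtype.val h0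
            refine ⟨⟨a, ?_⟩, rfl⟩
            simpa [hk] using hx
          · rintro ⟨y, hy⟩
            rw [← hy]
            rfl

/-- A cover g of B also covers C, and the new kernel is an extension of `ker p` by `ker g`. This is
the dimension shift: the kernel may be one degree worse than B. -/
theorem quotient {n : ℕ} (p : B →ₗ[R] C) (hp : Function.Surjective p)
    (hA : IsFP R n (LinearMap.ker p)) (hB : IsFP R (n + 1) B) : IsFP R (n + 1) C := by
  obtain ⟨P, _, _, g, hPf, hPp, hg, hk⟩ := hB
  refine ⟨P, _, _, p ∘ₗ g, hPf, hPp, hp.comp hg, ?_⟩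
  let r : LinearMap.ker (p ∘ₗ g) →ₗ[R] LinearMap.ker p := g.restrict fun x hx => hx
  refine extension r ?_ ?_ hA
  · rintro ⟨b, hb⟩
    obtain ⟨x, rfl⟩ := hg b
    exact ⟨⟨x, hb⟩, rfl⟩
  · have hle : LinearMap.ker g ≤ LinearMap.ker (p ∘ₗ g) := LinearMap.ker_le_ker_comp g p
    refine hk.ker_of_exact (f := Submodule.inclusion hle) (Submodule.inclusion_injective hle) ?_
    rintro ⟨x, hx⟩
    constructor
    · intro h0
      exact ⟨⟨x, congrArg Subtype.val h0⟩, rfl⟩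
    · rintro ⟨y, hy⟩
      rw [← hy]
      exact Subtype.ext y.2

theorem pi {ι : Type u} [Finite ι] {n : ℕ} {M : ι → Type u} [∀ i, AddCommGroup (M i)]
    [∀ i, Module R (M i)] (h : ∀ i, IsFP R n (M i)) : IsFP R n (∀ i, M i) := by
  induction n generalizing M with
  | zero =>
    have (i : ι) : Module.Finite R (M i) := h i
    exact (inferInstance : Module.Finite R (∀ i, M i))
  | succ n ih =>
    choose P _ _ g hf hp hs hk using h
    have := Fintype.ofFinite ι
    classical
    have : Module.Projective R (∀ i, P i) :=
      Module.Projective.of_equiv (DFinsupp.linearEquivFunOnFintype (R := R) (M := P))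
    refine succ_of_exact (f := LinearMap.piMap fun i => (LinearMap.ker (g i)).subtype)
      (g := LinearMap.piMap g) ?_ ?_ ?_ (ih hk)
    · intro x y hxy
      funext i
      exact Subtype.ext (congrFun hxy i)
    · intro x
      constructor
      · intro h0
        exact ⟨fun i => ⟨x i, congrFun h0 i⟩, rfl⟩
      · rintro ⟨y, rfl⟩
        funext i
        exact (y i).2
    · intro y
      choose x hx using fun i => hs i (y i)
      exact ⟨x, funext hx⟩

/-- A module resolved by modules of type `FP_n` is of type `FP_n`. -/
theorem of_resolution {X : ℕ → Type u} [∀ i, AddCommGroup (X i)] [∀ i, Module R (X i)]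
    (d : ∀ i, X (i + 1) →ₗ[R] X i) (ε : X 0 →ₗ[R] M) (hε : Function.Surjective ε)
    (h₀ : Function.Exact (d 0) ε) (h : ∀ i, Function.Exact (d (i + 1)) (d i)) {n : ℕ}
    (hX : ∀ i ≤ n, ∀ j ≤ n, IsFP R j (X i)) : IsFP R n M := by
  -- The image of `d i` is the quotient of `X (i + 1)` by the image of `d (i + 1)`, so one degree of
  -- finiteness is lost for each step up the resolution.
  have key (m : ℕ) : ∀ i, i + m + 1 ≤ n → IsFP R m (LinearMap.range (d i)) := by
    induction m with
    | zero =>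
      intro i hi
      have := (hX (i + 1) (by omega) 0 (by omega)).finite
      exact Module.Finite.of_surjective (d i).rangeRestrict (d i).surjective_rangeRestrict
    | succ m ih =>
      intro i hi
      refine quotient (d i).rangeRestrict (d i).surjective_rangeRestrict ?_
        (hX (i + 1) (by omega) _ (by omega))
      rw [LinearMap.ker_rangeRestrict, LinearMap.exact_iff.1 (h i)]
      exact ih (i + 1) (by omega)
  cases n with
  | zero =>
    have := (hX 0 le_rfl 0 le_rfl).finite
    exact Module.Finite.of_surjective ε hε
  | succ n =>
    refine quotient ε hε ?_ (hX 0 (by omega) _ le_rfl)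
    rw [LinearMap.exact_iff.1 h₀]
    exact key n 0 (by omega)

end

end IsFP

/-! ### Comparison with projective resolutions -/

theorem moduleCat_exact_iff_function_exact {R : Type u} [Ring R]
    (S : ShortComplex (ModuleCat.{u} R)) : S.Exact ↔ Function.Exact S.f.hom S.g.hom := by
  rw [ShortComplex.moduleCat_exact_iff_range_eq_ker, LinearMap.exact_iff, eq_comm]

theorem CategoryTheory.ProjectiveResolution.isFP {R : Type u} [Ring R] {M : ModuleCat.{u} R}
    (P : ProjectiveResolution M) {n : ℕ} (h : ∀ i ≤ n, Module.Finite R (P.complex.X i)) :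
    IsFP R n M := by
  have hp (i : ℕ) : Module.Projective R (P.complex.X i) :=
    (IsProjective.iff_projective _).2 (P.projective i)
  refine IsFP.of_resolution (X := fun i => P.complex.X i)
    (fun i => (P.complex.d (i + 1) i).hom) (P.π.f 0).hom
    ((ModuleCat.epi_iff_surjective _).1 inferInstance) ?_ ?_ ?_
  · exact (moduleCat_exact_iff_function_exact _).1 P.exact₀
  · intro i
    exact (moduleCat_exact_iff_function_exact _).1 (P.exact_succ i)
  · intro i hi j _
    have := h i hi
    exact IsFP.of_projective j

/-- Splicing a projective resolution of `K` with a short exact sequence `0 ⟶ K ⟶ P ⟶ M ⟶ 0`. -/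
theorem CategoryTheory.ProjectiveResolution.exists_splice {C : Type v} [Category.{u} C] [Abelian C]
    (S : ShortComplex C) (hS : S.ShortExact) [Projective S.X₂] (Q : ProjectiveResolution S.X₁) :
    ∃ Q' : ProjectiveResolution S.X₃, Q'.complex.X 0 = S.X₂ ∧
      ∀ i, Q'.complex.X (i + 1) = Q.complex.X i := by
  have := hS.mono_f
  have := hS.epi_g
  let p : Q.complex.X 0 ⟶ S.X₁ := Q.π.f 0
  have hp : Q.complex.d 1 0 ≫ p = 0 := Q.complex_d_comp_π_f_zero
  have : Epi p := inferInstanceAs (Epi (Q.π.f 0))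
  let f : Q.complex.X 0 ⟶ S.X₂ := p ≫ S.f
  have w : Q.complex.d 1 0 ≫ f = 0 := by
    rw [← Category.assoc, hp, Limits.zero_comp]
  have w' : f ≫ S.g = 0 := by simp [f]
  -- Precomposing with the epimorphism p leaves the image in `S.X₂` unchanged; in `he'` below,
  -- postcomposing with the monomorphism `S.f` leaves the kernel unchanged.
  have he : (ShortComplex.mk f S.g w').Exact := by
    let φ : ShortComplex.mk f S.g w' ⟶ S :=
      { τ₁ := p, τ₂ := 𝟙 _, τ₃ := 𝟙 _ }
    have : Epi φ.τ₁ := inferInstanceAs (Epi p)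
    have : IsIso φ.τ₂ := inferInstanceAs (IsIso (𝟙 _))
    have : Mono φ.τ₃ := inferInstanceAs (Mono (𝟙 _))
    exact (ShortComplex.exact_iff_of_epi_of_isIso_of_mono φ).2 hS.exact
  have he' : (ShortComplex.mk (Q.complex.d 1 0) f w).Exact := by
    let φ : ShortComplex.mk _ _ hp ⟶ ShortComplex.mk _ f w :=
      { τ₁ := 𝟙 _, τ₂ := 𝟙 _, τ₃ := S.f }
    have : Epi φ.τ₁ := inferInstanceAs (Epi (𝟙 _))
    have : IsIso φ.τ₂ := inferInstanceAs (IsIso (𝟙 _))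
    have : Mono φ.τ₃ := inferInstanceAs (Mono S.f)
    exact (ShortComplex.exact_iff_of_epi_of_isIso_of_mono φ).1 Q.exact₀
  refine ⟨{ complex := Q.complex.augment f w
            projective := ?_
            π := (ChainComplex.toSingle₀Equiv _ _).symm ⟨S.g, w'⟩
            quasiIso := ⟨fun n => ?_⟩ }, rfl, fun i => rfl⟩
  · rintro (_ | i)
    · assumption
    · exact Q.projective i
  · cases n
    · rw [ChainComplex.quasiIsoAt₀_iff, ShortComplex.quasiIso_iff_of_zeros']
      · refine (ShortComplex.exact_and_epi_g_iff_of_iso ?_).2 ⟨he, hS.epi_g⟩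
        exact ShortComplex.isoMk (Iso.refl _) (Iso.refl _) (Iso.refl _)
          ((Category.id_comp _).trans (Category.comp_id _).symm)
          ((Category.id_comp _).trans ((Category.comp_id _).trans
            (ChainComplex.toSingle₀Equiv_symm_apply_f_zero (C := Q.complex.augment f w) S.g w')).symm)
      all_goals rfl
    · rename_i n
      rw [quasiIsoAt_iff_exactAt']
      · rw [HomologicalComplex.exactAt_iff' _ (n + 1 + 1) (n + 1) n (by simp) (by simp)]
        cases n with
        | zero => exact he'
        | succ n => exact Q.exact_succ n
      · apply ChainComplex.exactAt_succ_single_obj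

theorem IsFP.exists_projectiveResolution {R : Type u} [Ring R] {n : ℕ} {M : Type u}
    [AddCommGroup M] [Module R M] (h : IsFP R n M) :
    ∃ P : ProjectiveResolution (ModuleCat.of R M), ∀ i ≤ n, Module.Finite R (P.complex.X i) := by
  have splice {M P : Type u} [AddCommGroup M] [Module R M] [AddCommGroup P] [Module R P]
      [Module.Projective R P] [Module.Finite R P] (g : P →ₗ[R] M) (hg : Function.Surjective g)
      (Q : ProjectiveResolution (ModuleCat.of R (LinearMap.ker g))) :
      ∃ Q' : ProjectiveResolution (ModuleCat.of R M), Module.Finite R (Q'.complex.X 0) ∧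
        ∀ i, Q'.complex.X (i + 1) = Q.complex.X i := by
    let S : ShortComplex (ModuleCat.{u} R) :=
      ShortComplex.mk (ModuleCat.ofHom (LinearMap.ker g).subtype) (ModuleCat.ofHom g)
        (by ext x; exact x.2)
    have hS : S.ShortExact :=
      { exact := (moduleCat_exact_iff_function_exact _).2
          (LinearMap.exact_subtype_ker_map g)
        mono_f := (ModuleCat.mono_iff_injective _).2 Subtype.val_injective
        epi_g := (ModuleCat.epi_iff_surjective _).2 hg }
    have : Projective S.X₂ := (IsProjective.iff_projective P).1 inferInstance
    obtain ⟨Q', h0, h1⟩ := Q.exists_splice S hS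
    refine ⟨Q', ?_, h1⟩
    rw [h0]
    assumption
  induction n generalizing M with
  | zero =>
    have : Module.Finite R M := h
    obtain ⟨k, g, hg⟩ := Module.Finite.exists_fin' R M
    -- Only degree 0 must be finitely generated, so any projective resolution of the kernel will do.
    obtain ⟨Q, h0, -⟩ := splice g hg (ProjectiveResolution.of _)
    refine ⟨Q, fun i hi => ?_⟩
    obtain rfl : i = 0 := by omega
    exact h0
  | succ n ih =>
    obtain ⟨P, _, _, g, hf, hp, hs, hk⟩ := h
    obtain ⟨Q, hQ⟩ := ih hk
    obtain ⟨Q', h0, h1⟩ := splice g hs Q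
    refine ⟨Q', fun i hi => ?_⟩
    cases i with
    | zero => exact h0
    | succ i =>
      rw [h1]
      exact hQ i (by omega)

theorem isTypeFP_iff_isFP {G : Type u} [Group G] {n : ℕ} :
    IsTypeFP G n ↔ IsFP (MonoidAlgebra ℤ G) n (trivialIntModule G) :=
  ⟨fun ⟨P, hP⟩ => P.isFP hP, fun h => h.exists_projectiveResolution⟩

/-! ### Restriction to subgroups of finite index -/

section Equivariant

variable {G : Type*} [Group G] {A : Type*} [Ring A] (φ : MonoidAlgebra ℤ G →+* A)
  {M N : Type*} [AddCommGroup M] [Module (MonoidAlgebra ℤ G) M] [AddCommGroup N] [Module A N]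

/-- An additive map that commutes with the action of the group elements is semilinear over the
group ring. -/
def semilinearOfEquivariant (f : M →+ N)
    (h : ∀ g m, f (MonoidAlgebra.of ℤ G g • m) = φ (MonoidAlgebra.of ℤ G g) • f m) :
    M →ₛₗ[φ] N where
  __ := f
  map_smul' r m := by
    change f (r • m) = φ r • f m
    induction r using MonoidAlgebra.induction_on with
    | of g => exact h g m
    | add x y hx hy => rw [add_smul, map_add, hx, hy, map_add, add_smul]
    | smul z x hx => rw [smul_assoc, map_zsmul, hx, map_zsmul, smul_assoc]

end Equivariant

/-- P is a retract of the free module `P →₀ S`, which over R is a direct sum of copies of the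
projective module S. -/
theorem Module.Projective.restrictScalars {R S P : Type*} [Ring R] [Ring S] [Module R S]
    [IsScalarTower R S S] [AddCommGroup P] [Module R P] [Module S P] [IsScalarTower R S P]
    [Module.Projective R S] [Module.Projective S P] : Module.Projective R P := by
  obtain ⟨s, hs⟩ := Module.projective_def'.1 (inferInstance : Module.Projective S P)
  have : Module.Projective R (P →₀ S) := by
    classical
    exact Module.Projective.of_equiv (finsuppLequivDFinsupp R).symm
  have key := Module.Projective.of_split (R := R) (M := P →₀ S) (P := P)
    (s.restrictScalars R) ((Finsupp.linearCombination S id).restrictScalars R)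
  exact key (by ext x; exact LinearMap.congr_fun hs x)

theorem IsFP.restrictScalars {R S : Type u} [Ring R] [Ring S] [Module R S] [IsScalarTower R S S]
    [Module.Finite R S] [Module.Projective R S] {n : ℕ} {M : Type u} [AddCommGroup M] [Module R M]
    [Module S M] [IsScalarTower R S M] (h : IsFP S n M) : IsFP R n M := by
  induction n generalizing M with
  | zero =>
    have : Module.Finite S M := h
    exact Module.Finite.trans S M
  | succ n ih =>
    obtain ⟨P, _, _, g, hf, hp, hs, hk⟩ := h
    -- The cover is given only over S; its R-structure is pulled back along R → S.
    let _ : Module R P := Module.compHom P (RingHom.smulOneHom : R →+* S)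
    have : IsScalarTower R S P := ⟨fun r s p => by
      change _ = (r • (1 : S)) • s • p
      rw [smul_smul, smul_one_mul]⟩
    have : Module.Finite R P := Module.Finite.trans S P
    have : Module.Projective R P := Module.Projective.restrictScalars (S := S)
    exact succ_of_exact (f := (LinearMap.ker g).subtype.restrictScalars R)
      (g := g.restrictScalars R) Subtype.val_injective (LinearMap.exact_subtype_ker_map g) hs
      (ih hk)

section FiniteIndex

variable {H K : Type u} [Group H] [Group K] (θ : H →* K)

/-- ℤK is free over ℤH on representatives of the right cosets of θ(H). Writing k = θ(r k) · t k,
with t constant on cosets and r equivariant, a lift chosen at the representatives extends linearly.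
-/
theorem MonoidAlgebra.projective_compHom (hθ : Function.Injective θ) :
    letI := Module.compHom (MonoidAlgebra ℤ K) (MonoidAlgebra.mapDomainRingHom ℤ θ)
    Module.Projective (MonoidAlgebra ℤ H) (MonoidAlgebra ℤ K) := by
  let _ := Module.compHom (MonoidAlgebra ℤ K) (MonoidAlgebra.mapDomainRingHom ℤ θ)
  have hsmul (x : H) (a : MonoidAlgebra ℤ K) : MonoidAlgebra.of ℤ H x • a =
      MonoidAlgebra.of ℤ K (θ x) * a := by
    change MonoidAlgebra.mapDomainRingHom ℤ θ _ * a = _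
    simp
  let s := QuotientGroup.rightRel θ.range
  let t (k : K) : K := (Quotient.mk s k).out
  have ht (x : H) (k : K) : t (θ x * k) = t k :=
    congrArg Quotient.out (Quotient.sound (QuotientGroup.rightRel_apply.2 ⟨x⁻¹, by simp⟩))
  have hr (k : K) : ∃ x : H, θ x * t k = k := by
    obtain ⟨x, hx⟩ := QuotientGroup.rightRel_apply.1 (Quotient.mk_out (s := s) k)
    exact ⟨x, by rw [hx]; simp [t]⟩
  choose r hr using hr
  have hrm (x : H) (k : K) : r (θ x * k) = x * r k := by
    apply hθ
    have h1 := hr (θ x * k)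
    rw [ht] at h1
    apply mul_right_cancel (b := t k)
    rw [h1, map_mul, mul_assoc, hr]
  refine Module.Projective.of_lifting_property fun {N N'} _ _ _ _ p f hp => ?_
  choose l hl using hp
  let ψ : MonoidAlgebra ℤ K →+ N := (Finsupp.liftAddHom fun k =>
    (zmultiplesHom N (MonoidAlgebra.of ℤ H (r k) •
      l (f (MonoidAlgebra.of ℤ K (t k)))))).comp MonoidAlgebra.coeffAddEquiv.toAddMonoidHom
  have hψ (k : K) : ψ (MonoidAlgebra.of ℤ K k) = MonoidAlgebra.of ℤ H (r k) •
      l (f (MonoidAlgebra.of ℤ K (t k))) := by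
    simp [ψ]
  refine ⟨semilinearOfEquivariant (RingHom.id (MonoidAlgebra ℤ H)) ψ fun x m => ?_, ?_⟩
  · induction m using MonoidAlgebra.induction_on with
    | of k =>
      rw [hsmul, ← map_mul, hψ, hψ, ht, hrm, map_mul, mul_smul]
      rfl
    | add x y hx hy => rw [smul_add, map_add, hx, hy, map_add, smul_add]
    | smul z x hx => rw [smul_comm, map_zsmul, hx, map_zsmul, smul_comm]
  · apply LinearMap.ext
    intro m
    induction m using MonoidAlgebra.induction_on with
    | of k =>
      change p (ψ _) = _
      rw [hψ, map_smul, hl, ← map_smul, hsmul, ← map_mul, hr]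
    | add x y hx hy => rw [map_add, hx, hy, map_add]
    | smul z x hx => rw [map_zsmul, hx, map_zsmul]

theorem MonoidAlgebra.finite_compHom [θ.range.FiniteIndex] :
    letI := Module.compHom (MonoidAlgebra ℤ K) (MonoidAlgebra.mapDomainRingHom ℤ θ)
    Module.Finite (MonoidAlgebra ℤ H) (MonoidAlgebra ℤ K) := by
  let _ := Module.compHom (MonoidAlgebra ℤ K) (MonoidAlgebra.mapDomainRingHom ℤ θ)
  have hsmul (x : H) (a : MonoidAlgebra ℤ K) : MonoidAlgebra.of ℤ H x • a =
      MonoidAlgebra.of ℤ K (θ x) * a := by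
    change MonoidAlgebra.mapDomainRingHom ℤ θ _ * a = _
    simp
  let s := QuotientGroup.rightRel θ.range
  have : Finite (Quotient s) :=
    Finite.of_equiv _ (QuotientGroup.quotientRightRelEquivQuotientLeftRel θ.range).symm
  refine ⟨(Submodule.fg_def (R := MonoidAlgebra ℤ H)).2
    ⟨Set.range fun q : Quotient s => MonoidAlgebra.of ℤ K q.out, Set.finite_range _, ?_⟩⟩
  rw [eq_top_iff]
  rintro m -
  induction m using MonoidAlgebra.induction_on with
  | of k =>
    obtain ⟨x, hx⟩ := QuotientGroup.rightRel_apply.1 (Quotient.mk_out (s := s) k)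
    have hk : MonoidAlgebra.of ℤ K k =
        MonoidAlgebra.of ℤ H x • MonoidAlgebra.of ℤ K (Quotient.mk s k).out := by
      rw [hsmul, ← map_mul, hx]
      simp
    rw [hk]
    exact Submodule.smul_mem _ _ (Submodule.subset_span ⟨_, rfl⟩)
  | add x y hx hy => exact add_mem hx hy
  | smul z x hx => exact zsmul_mem hx z

theorem trivialIntModule_of_smul {G : Type u} [Group G] (g : G) (m : trivialIntModule G) :
    MonoidAlgebra.of ℤ G g • m = m :=
  LinearMap.congr_fun
    (Representation.asAlgebraHom_of (Representation.trivial ℤ G (ULift.{u} ℤ)) g) m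

theorem IsTypeFP.of_finiteIndex (hθ : Function.Injective θ) [θ.range.FiniteIndex] {n : ℕ}
    (h : IsTypeFP K n) : IsTypeFP H n := by
  rw [isTypeFP_iff_isFP] at h ⊢
  let _ := Module.compHom (MonoidAlgebra ℤ K) (MonoidAlgebra.mapDomainRingHom ℤ θ)
  let _ := Module.compHom (trivialIntModule K) (MonoidAlgebra.mapDomainRingHom ℤ θ)
  have : IsScalarTower (MonoidAlgebra ℤ H) (MonoidAlgebra ℤ K) (MonoidAlgebra ℤ K) :=
    ⟨fun r s p => mul_assoc (MonoidAlgebra.mapDomainRingHom ℤ θ r) s p⟩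
  have : IsScalarTower (MonoidAlgebra ℤ H) (MonoidAlgebra ℤ K) (trivialIntModule K) :=
    ⟨fun r s p => mul_smul (MonoidAlgebra.mapDomainRingHom ℤ θ r) s p⟩
  have := MonoidAlgebra.projective_compHom θ hθ
  have := MonoidAlgebra.finite_compHom θ
  have h' : IsFP (MonoidAlgebra ℤ H) n (trivialIntModule K) := h.restrictScalars
  let e₀ : trivialIntModule K →+ trivialIntModule H := AddMonoidHom.id (ULift.{u} ℤ)
  let e : trivialIntModule K →ₗ[MonoidAlgebra ℤ H] trivialIntModule H :=
    semilinearOfEquivariant (RingHom.id (MonoidAlgebra ℤ H)) e₀ fun x m => by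
      have hx : MonoidAlgebra.of ℤ H x • m = m := by
        change MonoidAlgebra.mapDomainRingHom ℤ θ _ • m = m
        simpa using trivialIntModule_of_smul (θ x) m
      rw [hx]
      exact (trivialIntModule_of_smul x (e₀ m)).symm
  exact h'.of_equiv (LinearEquiv.ofBijective e Function.bijective_id)

end FiniteIndex

/-! ### Induction from a point stabiliser -/

theorem Representation.of_smul_asModule {G V : Type*} [Group G] [AddCommGroup V]
    (ρ : Representation ℤ G V) (g : G) (v : ρ.asModule) :
    MonoidAlgebra.of ℤ G g • v = ρ g v :=
  LinearMap.congr_fun (Representation.asAlgebraHom_of ρ g) v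

/-- A section of the orbit map `G → Y`, `g ↦ g • y₀`, that maps `y₀` to `1`. -/
structure OrbitSection (G : Type u) [Group G] (Y : Type u) [MulAction G Y] (y₀ : Y) where
  /-- the section -/
  toFun : Y → G
  smul_eq : ∀ y, toFun y • y₀ = y
  map_base : toFun y₀ = 1

theorem OrbitSection.nonempty (G : Type u) [Group G] (Y : Type u) [MulAction G Y]
    [MulAction.IsPretransitive G Y] (y₀ : Y) : Nonempty (OrbitSection G Y y₀) := by
  classical
  choose s hs using MulAction.exists_smul_eq G y₀
  refine ⟨⟨fun y => if y = y₀ then 1 else s y, fun y => ?_, if_pos rfl⟩⟩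
  split_ifs with h
  · rw [one_smul, h]
  · exact hs y

namespace OrbitSection

variable {G : Type u} [Group G] {Y : Type u} [MulAction G Y] {y₀ : Y} (σ : OrbitSection G Y y₀)

/-- The cocycle `(g, y) ↦ σ(gy)⁻¹ g σ(y)` with values in the stabilizer of the base point. -/
def cocycle (g : G) (y : Y) : MulAction.stabilizer G y₀ :=
  ⟨(σ.toFun (g • y))⁻¹ * g * σ.toFun y, by
    rw [MulAction.mem_stabilizer_iff, mul_smul, mul_smul, σ.smul_eq, inv_smul_eq_iff, σ.smul_eq]⟩

theorem cocycle_one (y : Y) : σ.cocycle 1 y = 1 := by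
  ext
  simp [cocycle]

theorem cocycle_mul (g h : G) (y : Y) :
    σ.cocycle (g * h) y = σ.cocycle g (h • y) * σ.cocycle h y := by
  ext
  simp [cocycle, mul_smul, mul_assoc]

theorem cocycle_base (h : MulAction.stabilizer G y₀) : σ.cocycle h y₀ = h := by
  have h1 : (h : G) • y₀ = y₀ := h.2
  ext
  simp [cocycle, h1, σ.map_base]

theorem cocycle_toFun (y : Y) : σ.cocycle (σ.toFun y) y₀ = 1 := by
  ext
  simp [cocycle, σ.smul_eq, σ.map_base]

section

variable (M : Type u) [AddCommGroup M] [Module (MonoidAlgebra ℤ (MulAction.stabilizer G y₀)) M]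

/-- The representation of `G` induced from a representation of the stabilizer of `y₀`, realized on
the finitely supported functions from the orbit of `y₀`. -/
noncomputable def inducedRep : Representation ℤ G (Y →₀ M) where
  toFun g := (Finsupp.liftAddHom fun y => (Finsupp.singleAddHom (g • y)).comp
    (DistribSMul.toAddMonoidHom M
      (MonoidAlgebra.of ℤ (MulAction.stabilizer G y₀) (σ.cocycle g y)))).toIntLinearMap
  map_one' := by
    ext y m : 2
    simp [cocycle_one, -MonoidAlgebra.of_apply]
  map_mul' g h := by
    ext y m : 2
    simp [cocycle_mul, mul_smul, -MonoidAlgebra.of_apply]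

theorem inducedRep_single (g : G) (y : Y) (m : M) :
    σ.inducedRep M g (Finsupp.single y m) = Finsupp.single (g • y)
      (MonoidAlgebra.of ℤ (MulAction.stabilizer G y₀) (σ.cocycle g y) • m) := by
  simp [inducedRep]

/-- The induced module. -/
abbrev Ind : Type u := (σ.inducedRep M).asModule

/-- The element of the induced module supported at `y` with value `m`. -/
noncomputable def single (y : Y) : M →+ σ.Ind M := Finsupp.singleAddHom y

theorem of_smul_single (g : G) (y : Y) (m : M) :
    MonoidAlgebra.of ℤ G g • σ.single M y m = σ.single M (g • y)
      (MonoidAlgebra.of ℤ (MulAction.stabilizer G y₀) (σ.cocycle g y) • m) :=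
  (Representation.of_smul_asModule _ _ _).trans (σ.inducedRep_single M g y m)

theorem single_eq (y : Y) (m : M) :
    σ.single M y m = MonoidAlgebra.of ℤ G (σ.toFun y) • σ.single M y₀ m := by
  rw [of_smul_single, σ.smul_eq, cocycle_toFun, map_one, one_smul]

/-- The value at `y` of an element of the induced module. -/
def coeff (x : σ.Ind M) (y : Y) : M := DFunLike.coe (F := Y →₀ M) x y

theorem coeff_injective : Function.Injective (σ.coeff M) := DFunLike.coe_injective (F := Y →₀ M)

@[elab_as_elim]
theorem ind_induction {p : σ.Ind M → Prop} (x : σ.Ind M) (h0 : p 0)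
    (hadd : ∀ x y, p x → p y → p (x + y)) (hs : ∀ y m, p (σ.single M y m)) : p x :=
  Finsupp.induction_linear x h0 hadd hs

/-- Every element supported at one point y is the σ(y)-translate of one supported at y₀, so
generators of M placed at y₀ suffice. -/
theorem finite_ind [Module.Finite (MonoidAlgebra ℤ (MulAction.stabilizer G y₀)) M] :
    Module.Finite (MonoidAlgebra ℤ G) (σ.Ind M) := by
  let φ : MonoidAlgebra ℤ (MulAction.stabilizer G y₀) →+* MonoidAlgebra ℤ G :=
    MonoidAlgebra.mapDomainRingHom ℤ (MulAction.stabilizer G y₀).subtype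
  let L : M →ₛₗ[φ] σ.Ind M := semilinearOfEquivariant φ (σ.single M y₀) fun g m => by
    have h1 : φ (MonoidAlgebra.of ℤ _ g) = MonoidAlgebra.of ℤ G g := by simp [φ]
    have h2 : (g : G) • y₀ = y₀ := g.2
    rw [h1, of_smul_single, cocycle_base, h2]
  obtain ⟨s, hs, hst⟩ := Submodule.fg_def.1
    (Module.Finite.fg_top (R := MonoidAlgebra ℤ (MulAction.stabilizer G y₀)) (M := M))
  refine ⟨Submodule.fg_def.2 ⟨L '' s, hs.image _, ?_⟩⟩
  have key : ⊤ ≤ (Submodule.span (MonoidAlgebra ℤ G) (L '' s)).comap L := by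
    rw [← hst, Submodule.span_le]
    exact fun m hm => Submodule.subset_span ⟨m, hm, rfl⟩
  rw [eq_top_iff]
  rintro x -
  induction x using σ.ind_induction M with
  | h0 => exact zero_mem _
  | hadd x y hx hy => exact add_mem hx hy
  | hs y m =>
    rw [single_eq]
    exact Submodule.smul_mem _ _ (key (Submodule.mem_top (x := m)))

/-- Frobenius reciprocity: a lift over the stabiliser, made on the copy of M at y₀, is spread over
the orbit by σ. -/
theorem projective_ind [Module.Projective (MonoidAlgebra ℤ (MulAction.stabilizer G y₀)) M] :
    Module.Projective (MonoidAlgebra ℤ G) (σ.Ind M) := by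
  refine Module.Projective.of_lifting_property fun {N N'} _ _ _ _ p f hp => ?_
  let φ : MonoidAlgebra ℤ (MulAction.stabilizer G y₀) →+* MonoidAlgebra ℤ G :=
    MonoidAlgebra.mapDomainRingHom ℤ (MulAction.stabilizer G y₀).subtype
  have hφ (g) : φ (MonoidAlgebra.of ℤ _ g) = MonoidAlgebra.of ℤ G g := by simp [φ]
  let _ : Module (MonoidAlgebra ℤ (MulAction.stabilizer G y₀)) N := Module.compHom N φ
  let _ : Module (MonoidAlgebra ℤ (MulAction.stabilizer G y₀)) N' := Module.compHom N' φ
  have hN (g) (n : N) : MonoidAlgebra.of ℤ (MulAction.stabilizer G y₀) g • n =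
      MonoidAlgebra.of ℤ G g • n := congrArg (· • n) (hφ g)
  have hN' (g) (n : N') : MonoidAlgebra.of ℤ (MulAction.stabilizer G y₀) g • n =
      MonoidAlgebra.of ℤ G g • n := congrArg (· • n) (hφ g)
  let p' : N →ₗ[MonoidAlgebra ℤ (MulAction.stabilizer G y₀)] N' :=
    semilinearOfEquivariant (RingHom.id (MonoidAlgebra ℤ (MulAction.stabilizer G y₀)))
      (p : N →+ N') fun g n => by
        rw [RingHom.id_apply, hN, hN']
        exact p.map_smul _ _
  let f' : M →ₗ[MonoidAlgebra ℤ (MulAction.stabilizer G y₀)] N' :=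
    semilinearOfEquivariant (RingHom.id (MonoidAlgebra ℤ (MulAction.stabilizer G y₀)))
      ((f : σ.Ind M →+ N').comp (σ.single M y₀)) fun g m => by
        have h2 : (g : G) • y₀ = y₀ := g.2
        have h3 := σ.of_smul_single M g y₀ m
        rw [cocycle_base, h2] at h3
        rw [RingHom.id_apply, hN']
        change f (σ.single M y₀ _) = _ • f (σ.single M y₀ m)
        rw [← h3, map_smul]
  obtain ⟨l, hl⟩ := Module.projective_lifting_property p' f' hp
  have hl' (m : M) : p (l m) = f (σ.single M y₀ m) := LinearMap.congr_fun hl m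
  let ψ : σ.Ind M →+ N := Finsupp.liftAddHom fun y =>
    (DistribSMul.toAddMonoidHom N (MonoidAlgebra.of ℤ G (σ.toFun y))).comp (l : M →+ N)
  have hψ (y : Y) (m : M) : ψ (σ.single M y m) = MonoidAlgebra.of ℤ G (σ.toFun y) • l m :=
    Finsupp.liftAddHom_apply_single _ _ _
  let Ψ : σ.Ind M →ₗ[MonoidAlgebra ℤ G] N :=
    semilinearOfEquivariant (RingHom.id (MonoidAlgebra ℤ G)) ψ fun g x => by
      induction x using σ.ind_induction M with
      | h0 => simp
      | hadd x y hx hy => rw [smul_add, map_add, hx, hy, map_add, smul_add]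
      | hs y m =>
        -- Equivariance reduces to σ(gy) · c(g, y) = g · σ(y), where c is the cocycle.
        rw [of_smul_single, hψ, hψ, map_smul, hN, RingHom.id_apply, ← mul_smul, ← mul_smul,
          ← map_mul, ← map_mul]
        congr 2
        simp [cocycle, mul_assoc]
  refine ⟨Ψ, LinearMap.ext fun x => ?_⟩
  induction x using σ.ind_induction M with
  | h0 => simp
  | hadd x y hx hy => rw [map_add, hx, hy, map_add]
  | hs y m =>
    change p (ψ _) = _
    rw [hψ, map_smul, hl', ← map_smul, ← single_eq]

end

variable {M N : Type u}
  [AddCommGroup M] [Module (MonoidAlgebra ℤ (MulAction.stabilizer G y₀)) M]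
  [AddCommGroup N] [Module (MonoidAlgebra ℤ (MulAction.stabilizer G y₀)) N]

/-- The additive map underlying `indMap`. -/
noncomputable def indAddMap (f : M →+ N) : σ.Ind M →+ σ.Ind N := Finsupp.mapRange.addMonoidHom f

theorem indAddMap_single (f : M →+ N) (y : Y) (m : M) :
    σ.indAddMap f (σ.single M y m) = σ.single N y (f m) :=
  Finsupp.mapRange_single (hf := map_zero f)

/-- Functoriality of the induced module. -/
noncomputable def indMap (f : M →ₗ[MonoidAlgebra ℤ (MulAction.stabilizer G y₀)] N) :
    σ.Ind M →ₗ[MonoidAlgebra ℤ G] σ.Ind N :=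
  semilinearOfEquivariant (RingHom.id (MonoidAlgebra ℤ G)) (σ.indAddMap (f : M →+ N)) fun g x => by
    induction x using σ.ind_induction M with
    | h0 => rw [smul_zero, map_zero, smul_zero]
    | hadd x y hx hy => rw [smul_add, map_add, hx, hy, map_add, smul_add]
    | hs y m =>
      rw [of_smul_single, indAddMap_single, indAddMap_single, RingHom.id_apply, of_smul_single]
      exact congrArg _ (map_smul f _ _)

theorem coeff_indMap (f : M →ₗ[MonoidAlgebra ℤ (MulAction.stabilizer G y₀)] N) (x : σ.Ind M)
    (y : Y) : σ.coeff N (σ.indMap f x) y = f (σ.coeff M x y) := rfl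

theorem indMap_injective {f : M →ₗ[MonoidAlgebra ℤ (MulAction.stabilizer G y₀)] N}
    (hf : Function.Injective f) : Function.Injective (σ.indMap f) :=
  Finsupp.mapRange_injective f (map_zero f) hf

theorem indMap_surjective {f : M →ₗ[MonoidAlgebra ℤ (MulAction.stabilizer G y₀)] N}
    (hf : Function.Surjective f) : Function.Surjective (σ.indMap f) :=
  Finsupp.mapRange_surjective f (map_zero f) hf

theorem indMap_exact (f : M →ₗ[MonoidAlgebra ℤ (MulAction.stabilizer G y₀)] N) :
    Function.Exact (σ.indMap (LinearMap.ker f).subtype) (σ.indMap f) := by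
  classical
  intro x
  constructor
  · intro hx
    have hx' (y : Y) : σ.coeff M x y ∈ LinearMap.ker f := by
      rw [LinearMap.mem_ker, ← coeff_indMap, hx]
      rfl
    -- A total function with r 0 = 0 is needed so that applying it pointwise preserves finite
    -- support; its values off the kernel never matter.
    let r : M → LinearMap.ker f := fun m => if h : m ∈ LinearMap.ker f then ⟨m, h⟩ else 0
    have hr : r 0 = 0 := by simp [r]
    let z : σ.Ind (LinearMap.ker f) := Finsupp.mapRange (M := M) r hr x
    have hz (y : Y) : σ.coeff _ z y = r (σ.coeff M x y) := rfl
    refine ⟨z, σ.coeff_injective M (funext fun y => ?_)⟩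
    rw [coeff_indMap, hz]
    simp only [r]
    rw [dif_pos (hx' y)]
    rfl
  · rintro ⟨z, rfl⟩
    exact σ.coeff_injective N (funext fun y => (σ.coeff _ z y).2)

theorem isFP_ind {n : ℕ} (h : IsFP (MonoidAlgebra ℤ (MulAction.stabilizer G y₀)) n M) :
    IsFP (MonoidAlgebra ℤ G) n (σ.Ind M) := by
  induction n generalizing M with
  | zero =>
    have : Module.Finite (MonoidAlgebra ℤ (MulAction.stabilizer G y₀)) M := h
    exact σ.finite_ind M
  | succ n ih =>
    obtain ⟨P, _, _, g, hf, hp, hs, hk⟩ := h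
    have := σ.finite_ind P
    have := σ.projective_ind P
    exact IsFP.succ_of_exact (σ.indMap_injective Subtype.val_injective) (σ.indMap_exact g)
      (σ.indMap_surjective hs) (ih hk)

end OrbitSection

/-! ### Permutation modules -/

section PermModule

variable (G : Type u) [Group G] (X : Type u) [MulAction G X]

/-- The permutation representation of `G` on `ℤX`. -/
noncomputable def permRep : Representation ℤ G (X →₀ ℤ) where
  toFun g := Finsupp.lmapDomain ℤ ℤ (g • ·)
  map_one' := by
    ext x : 2
    simp
  map_mul' g h := by
    ext x : 2
    simp [mul_smul]

/-- The permutation module `ℤX`. -/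
abbrev PermModule : Type u := (permRep G X).asModule

namespace PermModule

variable {X}

/-- The basis element of `ℤX` given by a point of `X`. -/
noncomputable def basis (x : X) : PermModule G X := Finsupp.single x (1 : ℤ)

variable {G}

theorem of_smul_basis (g : G) (x : X) :
    MonoidAlgebra.of ℤ G g • basis G x = basis G (g • x) :=
  (Representation.of_smul_asModule _ _ _).trans Finsupp.mapDomain_single

/-- The coefficient at a point of `X`. -/
def coeff (v : PermModule G X) (x : X) : ℤ := DFunLike.coe (F := X →₀ ℤ) v x

theorem coeff_injective : Function.Injective (coeff : PermModule G X → X → ℤ) :=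
  DFunLike.coe_injective (F := X →₀ ℤ)

theorem coeff_of_smul (g : G) (v : PermModule G X) (x : X) :
    coeff (MonoidAlgebra.of ℤ G g • v) x = coeff v (g⁻¹ • x) := by
  rw [Representation.of_smul_asModule]
  have h := Finsupp.mapDomain_apply (MulAction.injective g) (v : X →₀ ℤ) (g⁻¹ • x)
  rw [smul_inv_smul] at h
  exact h

@[elab_as_elim]
theorem induction {p : PermModule G X → Prop} (v : PermModule G X) (h0 : p 0)
    (hadd : ∀ v w, p v → p w → p (v + w)) (hneg : ∀ v, p v → p (-v))
    (hb : ∀ x, p (basis G x)) : p v := by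
  refine Finsupp.induction_linear (motive := p) v h0 hadd fun x z => ?_
  have hz : (Finsupp.single x z : X →₀ ℤ) = z • (Finsupp.single x 1 : X →₀ ℤ) := by simp
  rw [hz]
  change p (z • basis G x)
  have hn (n : ℕ) : p (n • basis G x) := by
    induction n with
    | zero => rwa [zero_smul]
    | succ n ih => rw [succ_nsmul]; exact hadd _ _ ih (hb x)
  obtain ⟨n, rfl | rfl⟩ := z.eq_nat_or_neg
  · rw [natCast_zsmul]; exact hn n
  · rw [neg_smul, natCast_zsmul]; exact hneg _ (hn n)

theorem hom_ext {N : Type*} [AddCommGroup N] {f f' : PermModule G X →+ N}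
    (h : ∀ x, f (basis G x) = f' (basis G x)) : f = f' := by
  ext v
  induction v using PermModule.induction with
  | h0 => rw [map_zero, map_zero]
  | hadd v w hv hw => rw [map_add, map_add, hv, hw]
  | hneg v hv => rw [map_neg, map_neg, hv]
  | hb x => exact h x

/-- The additive map on `ℤX` with prescribed values on `X`. -/
noncomputable def lift {N : Type*} [AddCommGroup N] (f : X → N) : PermModule G X →+ N :=
  (Finsupp.liftAddHom fun x => zmultiplesHom N (f x) : (X →₀ ℤ) →+ N)

@[simp]
theorem lift_basis {N : Type*} [AddCommGroup N] (f : X → N) (x : X) :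
    lift f (basis G x) = f x := by
  refine (Finsupp.liftAddHom_apply_single _ _ _).trans ?_
  simp

/-- An additive map on `ℤX` that is equivariant on `X` is linear over the group ring. -/
noncomputable def linearOfEquivariant {N : Type*} [AddCommGroup N] [Module (MonoidAlgebra ℤ G) N]
    (f : PermModule G X →+ N)
    (h : ∀ (g : G) x, f (basis G (g • x)) = MonoidAlgebra.of ℤ G g • f (basis G x)) :
    PermModule G X →ₗ[MonoidAlgebra ℤ G] N :=
  semilinearOfEquivariant (RingHom.id (MonoidAlgebra ℤ G)) f fun g v => by
    rw [RingHom.id_apply]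
    induction v using PermModule.induction with
    | h0 => rw [smul_zero, map_zero, smul_zero]
    | hadd v w hv hw => rw [smul_add, map_add, map_add, smul_add, hv, hw]
    | hneg v hv => rw [smul_neg, map_neg, map_neg, smul_neg, hv]
    | hb x => rw [of_smul_basis, h]

end PermModule

end PermModule

section

variable {G : Type u} [Group G] {X : Type u} [MulAction G X]

/-- The section forces the action to be transitive, so ℤX is induced from the trivial module of the
stabiliser of y₀. -/
theorem OrbitSection.isFP_permModule {y₀ : X} (σ : OrbitSection G X y₀) {n : ℕ}
    (h : IsTypeFP (MulAction.stabilizer G y₀) n) :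
    IsFP (MonoidAlgebra ℤ G) n (PermModule G X) := by
  let e₀ : σ.Ind (trivialIntModule (MulAction.stabilizer G y₀)) →+ PermModule G X :=
    (Finsupp.mapRange.addEquiv (AddEquiv.ulift (α := ℤ)) :
      (X →₀ ULift.{u} ℤ) ≃+ (X →₀ ℤ)).toAddMonoidHom
  have he₀ : Function.Bijective e₀ := (Finsupp.mapRange.addEquiv (AddEquiv.ulift (α := ℤ)) :
      (X →₀ ULift.{u} ℤ) ≃+ (X →₀ ℤ)).bijective
  have hs (y : X) (m : trivialIntModule (MulAction.stabilizer G y₀)) :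
      e₀ (σ.single _ y m) = (ULift.down (α := ℤ) m) • PermModule.basis G y := by
    refine (Finsupp.mapRange_single (hf := rfl)).trans ?_
    exact (Finsupp.smul_single_one _ _).symm
  let e : σ.Ind (trivialIntModule (MulAction.stabilizer G y₀)) →ₗ[MonoidAlgebra ℤ G]
      PermModule G X :=
    semilinearOfEquivariant (RingHom.id (MonoidAlgebra ℤ G)) e₀ fun g x => by
      rw [RingHom.id_apply]
      induction x using σ.ind_induction _ with
      | h0 => rw [smul_zero, map_zero, smul_zero]
      | hadd x y hx hy => rw [smul_add, map_add, hx, hy, map_add, smul_add]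
      | hs y m =>
        rw [σ.of_smul_single, trivialIntModule_of_smul, hs, hs, smul_comm,
          PermModule.of_smul_basis]
  exact (σ.isFP_ind (isTypeFP_iff_isFP.1 h)).of_equiv (LinearEquiv.ofBijective e he₀)

/-- The additive map underlying `restrictOrbit`. -/
noncomputable def PermModule.restrictOrbitAddHom (o : MulAction.orbitRel.Quotient G X) :
    PermModule G X →+ PermModule G o.orbit :=
  (Finsupp.subtypeDomainAddMonoidHom (p := (· ∈ o.orbit)) : (X →₀ ℤ) →+ _)

/-- Restriction of `ℤX` to an orbit. -/
noncomputable def PermModule.restrictOrbit (o : MulAction.orbitRel.Quotient G X) :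
    PermModule G X →ₗ[MonoidAlgebra ℤ G] PermModule G o.orbit :=
  semilinearOfEquivariant (RingHom.id (MonoidAlgebra ℤ G))
    (restrictOrbitAddHom o) fun g v =>
      coeff_injective (funext fun x => (coeff_of_smul g v x).trans
        (coeff_of_smul g (restrictOrbitAddHom o v) x).symm)

/-- A permutation module is the product of the permutation modules of its orbits. -/
theorem PermModule.bijective_pi_restrictOrbit [Finite (MulAction.orbitRel.Quotient G X)] :
    Function.Bijective (LinearMap.pi (restrictOrbit (G := G) (X := X))) := by
  have hm (x : X) : x ∈ MulAction.orbitRel.Quotient.orbit (Quotient.mk'' x : MulAction.orbitRel.Quotient G X) := by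
    rw [MulAction.orbitRel.Quotient.mem_orbit]
  constructor
  · intro v w h
    refine coeff_injective (funext fun x => ?_)
    exact congrArg (fun z => coeff z ⟨x, hm x⟩) (congrFun h (Quotient.mk'' x))
  · intro w
    -- The glued function has finite support because there are finitely many orbits and each
    -- component is finitely supported.
    have hfin : (Function.support fun x => coeff (w (Quotient.mk'' x)) ⟨x, hm x⟩).Finite := by
      refine (Set.finite_iUnion fun o : MulAction.orbitRel.Quotient G X =>
        (Finsupp.hasFiniteSupport (w o : o.orbit →₀ ℤ)).image Subtype.val).subset fun x hx => ?_
      exact Set.mem_iUnion.2 ⟨Quotient.mk'' x, ⟨x, hm x⟩, hx, rfl⟩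
    let v : PermModule G X := Finsupp.ofSupportFinite _ hfin
    refine ⟨v, funext fun o => coeff_injective (funext fun x => ?_)⟩
    change coeff (w (Quotient.mk'' x.1)) ⟨x, hm x⟩ = coeff (w o) x
    obtain ⟨x, hx⟩ := x
    obtain rfl := (MulAction.orbitRel.Quotient.mem_orbit.1 hx).symm
    rfl

theorem PermModule.isFP [Finite (MulAction.orbitRel.Quotient G X)] {n : ℕ}
    (h : ∀ x : X, IsTypeFP (MulAction.stabilizer G x) n) :
    IsFP (MonoidAlgebra ℤ G) n (PermModule G X) := by
  refine (IsFP.pi fun o => ?_).of_equiv (LinearEquiv.ofBijective _ bijective_pi_restrictOrbit).symm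
  obtain ⟨y⟩ : Nonempty o.orbit := (MulAction.orbitRel.Quotient.nonempty_orbit o).to_subtype
  obtain ⟨σ⟩ := OrbitSection.nonempty G o.orbit y
  refine σ.isFP_permModule ?_
  have hy : MulAction.stabilizer G y = MulAction.stabilizer G (y : X) := by
    ext g
    simp [MulAction.mem_stabilizer_iff, Subtype.ext_iff]
  rw [hy]
  exact h y

/-- Applied to the one-point set of empty tuples, this lets the augmentation be the lowest
differential of the tuple complex. -/
theorem isTypeFP_iff_permModule [Unique X] {n : ℕ} :
    IsTypeFP G n ↔ IsFP (MonoidAlgebra ℤ G) n (PermModule G X) := by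
  rw [isTypeFP_iff_isFP]
  let e₀ : PermModule G X →+ trivialIntModule G :=
    (AddEquiv.ulift.symm.toAddMonoidHom.comp (Finsupp.applyAddHom default) :
      (X →₀ ℤ) →+ ULift.{u} ℤ)
  let e : PermModule G X →ₗ[MonoidAlgebra ℤ G] trivialIntModule G :=
    PermModule.linearOfEquivariant e₀ fun g x => by
      rw [trivialIntModule_of_smul, Subsingleton.elim (g • x) x]
  have he : Function.Bijective e := by
    constructor
    · intro v w h
      refine PermModule.coeff_injective (funext fun x => ?_)
      rw [Subsingleton.elim x default]
      exact congrArg (ULift.down (α := ℤ)) h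
    · intro m
      exact ⟨(Finsupp.single default (ULift.down (α := ℤ) m) : X →₀ ℤ),
        congrArg (ULift.up (α := ℤ)) Finsupp.single_eq_same⟩
  let e' := LinearEquiv.ofBijective e he
  exact ⟨fun h => h.of_equiv e'.symm, fun h => h.of_equiv e'⟩

end

/-! ### The complex of tuples -/

namespace TupleComplex

open PermModule

variable {G : Type u} [Group G] {S : Type u} [MulAction G S]

/-- Prepending a point to a tuple. -/
noncomputable def cons {n : ℕ} (s : S) :
    PermModule G (Fin n → S) →+ PermModule G (Fin (n + 1) → S) :=
  lift fun x => basis G (Fin.cons s x : Fin (n + 1) → S)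

/-- The differential of the complex of tuples, characterized by `d (s, x) = x - (s, d x)`. -/
noncomputable def dAddHom : ∀ n : ℕ, PermModule G (Fin (n + 1) → S) →+ PermModule G (Fin n → S)
  | 0 => lift fun x => basis G (Fin.tail x)
  | n + 1 => lift fun x => basis G (Fin.tail x) - cons (x 0) (dAddHom n (basis G (Fin.tail x)))

theorem smul_cons {n : ℕ} (g : G) (s : S) (x : Fin n → S) :
    g • (Fin.cons s x : Fin (n + 1) → S) = Fin.cons (g • s) (g • x) := by
  funext i
  refine Fin.cases ?_ (fun i => ?_) i <;> simp

theorem of_smul_cons {n : ℕ} (g : G) (s : S) (v : PermModule G (Fin n → S)) :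
    MonoidAlgebra.of ℤ G g • cons s v = cons (g • s) (MonoidAlgebra.of ℤ G g • v) := by
  induction v using PermModule.induction with
  | h0 => rw [smul_zero, map_zero, map_zero, smul_zero]
  | hadd v w hv hw => rw [map_add, smul_add, smul_add, map_add, hv, hw]
  | hneg v hv => rw [map_neg, smul_neg, smul_neg, map_neg, hv]
  | hb x => rw [of_smul_basis, cons, cons, lift_basis, lift_basis, of_smul_basis, smul_cons]

theorem dAddHom_zero_cons (s : S) (v : PermModule G (Fin 0 → S)) :
    dAddHom 0 (cons s v) = v := by
  have h : (dAddHom 0).comp (cons s) = AddMonoidHom.id (PermModule G (Fin 0 → S)) :=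
    hom_ext fun x => by simp [dAddHom, cons]
  exact DFunLike.congr_fun h v

/-- The homotopy identity: prepending s is a contraction. The same formula yields d² = 0 by
induction. -/
theorem dAddHom_succ_cons {n : ℕ} (s : S) (v : PermModule G (Fin (n + 1) → S)) :
    dAddHom (n + 1) (cons s v) = v - cons s (dAddHom n v) := by
  have h : (dAddHom (n + 1)).comp (cons s) =
      AddMonoidHom.id (PermModule G (Fin (n + 1) → S)) - (cons s).comp (dAddHom n) :=
    hom_ext fun x => by simp [dAddHom, cons]
  exact DFunLike.congr_fun h v

theorem basis_eq_cons {n : ℕ} (x : Fin (n + 1) → S) :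
    basis G x = cons (x 0) (basis G (Fin.tail x)) := by
  rw [cons, lift_basis, Fin.cons_self_tail]

theorem dAddHom_comp_dAddHom (n : ℕ) (v : PermModule G (Fin (n + 2) → S)) :
    dAddHom n (dAddHom (n + 1) v) = 0 := by
  induction n with
  | zero =>
    induction v using PermModule.induction with
    | h0 => simp
    | hadd v w hv hw => rw [map_add, map_add, hv, hw, add_zero]
    | hneg v hv => rw [map_neg, map_neg, hv, neg_zero]
    | hb x =>
      rw [basis_eq_cons, dAddHom_succ_cons, map_sub, dAddHom_zero_cons, sub_self]
  | succ n ih =>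
    induction v using PermModule.induction with
    | h0 => simp
    | hadd v w hv hw => rw [map_add, map_add, hv, hw, add_zero]
    | hneg v hv => rw [map_neg, map_neg, hv, neg_zero]
    | hb x =>
      rw [basis_eq_cons, dAddHom_succ_cons, map_sub, dAddHom_succ_cons, ih, map_zero, sub_zero,
        sub_self]

theorem dAddHom_of_smul (n : ℕ) (g : G) (x : Fin (n + 1) → S) :
    dAddHom n (basis G (g • x)) = MonoidAlgebra.of ℤ G g • dAddHom n (basis G x) := by
  induction n with
  | zero =>
    rw [basis_eq_cons, basis_eq_cons, dAddHom_zero_cons, dAddHom_zero_cons, of_smul_basis]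
    rfl
  | succ n ih =>
    rw [basis_eq_cons, basis_eq_cons x, dAddHom_succ_cons, dAddHom_succ_cons, smul_sub,
      of_smul_cons, of_smul_basis, ← ih]
    rfl

/-- The differential of the complex of tuples. -/
noncomputable def d (n : ℕ) :
    PermModule G (Fin (n + 1) → S) →ₗ[MonoidAlgebra ℤ G] PermModule G (Fin n → S) :=
  linearOfEquivariant (dAddHom n) (dAddHom_of_smul n)

/-- The contraction by a fixed s need not be G-equivariant, but exactness concerns only the
underlying abelian groups. -/
theorem exact_d [Nonempty S] (n : ℕ) :
    Function.Exact (d (G := G) (S := S) (n + 1)) (d (G := G) (S := S) n) := by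
  obtain ⟨s⟩ := ‹Nonempty S›
  intro v
  constructor
  · intro hv
    refine ⟨cons s v, (dAddHom_succ_cons s v).trans ?_⟩
    rw [show dAddHom n v = 0 from hv, map_zero, sub_zero]
  · rintro ⟨w, rfl⟩
    exact dAddHom_comp_dAddHom n w

theorem surjective_d_zero [Nonempty S] : Function.Surjective (d (G := G) (S := S) 0) := by
  obtain ⟨s⟩ := ‹Nonempty S›
  exact fun v => ⟨cons s v, dAddHom_zero_cons s v⟩

end TupleComplex

theorem IsTypeFP.of_finite_orbits_tuples {G : Type u} [Group G] {S : Type u} [Nonempty S]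
    [MulAction G S] {n : ℕ} (hfin : ∀ m, Finite (MulAction.orbitRel.Quotient G (Fin m → S)))
    (hstab : ∀ m (x : Fin (m + 1) → S), IsTypeFPInfty (MulAction.stabilizer G x)) :
    IsTypeFP G n :=
  isTypeFP_iff_permModule.2 (IsFP.of_resolution (X := fun i => PermModule G (Fin (i + 1) → S))
    (fun i => TupleComplex.d (i + 1)) (TupleComplex.d 0) TupleComplex.surjective_d_zero
    (TupleComplex.exact_d 0) (fun i => TupleComplex.exact_d (i + 1))
    fun i _ j _ => PermModule.isFP fun x => hstab i x j)

/-! ### From finite subsets to tuples -/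

section Oligomorphic

variable {G : Type u} [Group G] {S : Type v} [MulAction G S]

theorem IsOligomorphic.finite_orbits_tuples (hS : IsOligomorphic G S) (m : ℕ) :
    Finite (MulAction.orbitRel.Quotient G (Fin m → S)) := by
  classical
  have hS' (k : ℕ) : Finite (MulAction.orbitRel.Quotient G (Set.powersetCard S k)) := by
    convert hS k
  -- Here k is the number of distinct entries, at most m. Each orbit of k-sets contributes one
  -- chosen representative, and every tuple can be translated to have all its entries in such a set.
  let T := Σ k : Fin (m + 1), Σ o : MulAction.orbitRel.Quotient G (Set.powersetCard S k),
    Fin m → (o.out : Set.powersetCard S k).1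
  let f : T → MulAction.orbitRel.Quotient G (Fin m → S) := fun t =>
    Quotient.mk'' fun i => (t.2.2 i : S)
  refine Finite.of_surjective f fun q => ?_
  induction q using Quotient.inductionOn' with
  | h x =>
    let A : Finset S := Finset.univ.image x
    have hA : A.card < m + 1 := Nat.lt_succ_of_le (Finset.card_image_le.trans (by simp))
    let B : Set.powersetCard S A.card := ⟨A, rfl⟩
    let o : MulAction.orbitRel.Quotient G (Set.powersetCard S A.card) := Quotient.mk'' B
    obtain ⟨g, hg⟩ : o.out ∈ MulAction.orbit G B :=
      MulAction.orbitRel_apply.1 (Quotient.mk_out (s := MulAction.orbitRel G _) B)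
    have hmem (i : Fin m) : g • x i ∈ o.out.1 := by
      rw [← hg]
      exact Finset.smul_mem_smul_finset (Finset.mem_image_of_mem x (Finset.mem_univ i))
    exact ⟨⟨⟨A.card, hA⟩, o, fun i => ⟨g • x i, hmem i⟩⟩,
      Quotient.sound' (MulAction.orbitRel_apply.2 ⟨g, rfl⟩)⟩

/-- The setwise stabiliser of the entries moves x only among the finitely many m-tuples with those
entries, so by orbit-stabiliser the stabiliser of x has finite index in it. -/
theorem isTypeFPInfty_stabilizer_tuple {m : ℕ} (x : Fin m → S)
    (h : IsTypeFPInfty (MulAction.stabilizer G (Set.range x))) :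
    IsTypeFPInfty (MulAction.stabilizer G x) := by
  intro n
  have hle : MulAction.stabilizer G x ≤ MulAction.stabilizer G (Set.range x) := by
    intro g hg
    rw [MulAction.mem_stabilizer_iff] at hg ⊢
    conv_rhs => rw [← hg]
    rw [← Set.image_smul, ← Set.range_comp]
    rfl
  have hfin : (Subgroup.inclusion hle).range.FiniteIndex := by
    let K := MulAction.stabilizer G (Set.range x)
    have hr : (Subgroup.inclusion hle).range = MulAction.stabilizer K x := by
      ext k
      constructor
      · rintro ⟨h, rfl⟩
        exact h.2
      · intro hk
        exact ⟨⟨k, hk⟩, rfl⟩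
    have hK (k : K) (i : Fin m) : k • x i ∈ Set.range x := by
      have h1 : (k : G) • Set.range x = Set.range x := k.2
      rw [← h1]
      exact Set.smul_mem_smul_set ⟨i, rfl⟩
    have : Finite (MulAction.orbit K x) := by
      refine ((Set.Finite.pi fun _ : Fin m => Set.finite_range x).subset ?_).to_subtype
      rintro _ ⟨k, rfl⟩
      exact fun i _ => hK k i
    have : Finite (K ⧸ MulAction.stabilizer K x) :=
      Finite.of_equiv _ (MulAction.orbitEquivQuotientStabilizer K x)
    rw [hr]
    exact Subgroup.finiteIndex_of_finite_quotient
  exact (h n).of_finiteIndex (Subgroup.inclusion hle) (Subgroup.inclusion_injective hle)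

/-- S is the image of a finite set of orbits times G. Hence S can be replaced by a copy in the
universe of G, where the modules live. -/
theorem small_of_finite_orbits [Finite (MulAction.orbitRel.Quotient G (Fin 1 → S))] :
    Small.{u} S := by
  let f : MulAction.orbitRel.Quotient G (Fin 1 → S) × G → S := fun p => p.2 • p.1.out 0
  refine small_of_surjective (f := f) fun s => ?_
  obtain ⟨g, hg⟩ := (MulAction.orbitRel G (Fin 1 → S)).symm
    (Quotient.mk_out (s := MulAction.orbitRel G (Fin 1 → S)) fun _ => s)
  exact ⟨(Quotient.mk'' fun _ => s, g), congrFun hg 0⟩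

end Oligomorphic

theorem mainTheorem12 (G : Type u) [Group G] (S : Type v) [Nonempty S] [MulAction G S]
    (hS : IsOligomorphic G S)
    (hstab : ∀ A : Set S, A.Nonempty → A.Finite → IsTypeFPInfty (MulAction.stabilizer G A)) :
    IsTypeFPInfty G := by
  intro n
  have hfin := hS.finite_orbits_tuples
  have : Small.{u} S := small_of_finite_orbits (G := G)
  let e : Shrink.{u} S ≃ S := (equivShrink S).symm
  -- The action is transported along e, so orbits and stabilisers of tuples correspond to those in
  -- S.
  let _ : MulAction G (Shrink.{u} S) := e.mulAction G
  have he (g : G) (s : Shrink.{u} S) : e (g • s) = g • e s := e.apply_symm_apply _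
  have : Nonempty (Shrink.{u} S) := e.nonempty
  have he' {m : ℕ} (g : G) (x : Fin m → Shrink.{u} S) : e ∘ (g • x) = g • (e ∘ x) :=
    funext fun i => he g (x i)
  have hinj (m : ℕ) : Function.Injective (fun x : Fin m → Shrink.{u} S => e ∘ x) :=
    e.injective.comp_left
  refine IsTypeFP.of_finite_orbits_tuples (S := Shrink.{u} S) (fun m => ?_) fun m x => ?_
  · let f : MulAction.orbitRel.Quotient G (Fin m → Shrink.{u} S) →
        MulAction.orbitRel.Quotient G (Fin m → S) :=
      Quotient.map' (fun x => e ∘ x) fun x y ⟨g, hg⟩ => ⟨g, by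
        dsimp only at hg ⊢
        rw [← he', hg]⟩
    have := hfin m
    refine Finite.of_injective f fun p q => ?_
    induction p using Quotient.inductionOn' with | h x => ?_
    induction q using Quotient.inductionOn' with | h y => ?_
    intro h
    obtain ⟨g, hg⟩ := MulAction.orbitRel_apply.1 (Quotient.exact' h)
    exact Quotient.sound' ⟨g, hinj m ((he' g y).trans hg)⟩
  · have hx : MulAction.stabilizer G x = MulAction.stabilizer G (e ∘ x) := by
      ext g
      rw [MulAction.mem_stabilizer_iff, MulAction.mem_stabilizer_iff, ← he', (hinj _).eq_iff]
    rw [hx]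
    exact isTypeFPInfty_stabilizer_tuple _
      (hstab _ (Set.range_nonempty _) (Set.finite_range _))
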